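/- Let $d\ge 1$ be an integer and $M>0$. For a probability measure $\pi$ on $\mathbb R^d$ put $f_\pi(x)=\int_{\mathbb R^d}\phi_d(x-\theta)\,d\pi(\theta)$, where $\phi_d(x)=(2\pi)^{-d/2}\exp(-\|x\|_2^2/2)$, and let $P_{f_\pi}$ be the distribution with density $f_\pi$. For probability densities $p,q$ on $\mathbb R^d$ let $H^2(p,q)=\frac12\int(\sqrt p-\sqrt q)^2$. Then there is a constant $c>0$, depending only on $M$ and $d$, such that for every sample size $n$ and every $\epsilon\in(0,1]$, $$\inf_{\widehat f}\ \sup_{\pi,Q}\ \mathbb E\left[H^2\bigl(f_\pi,\widehat f\,\bigr)\right]\ \ge\ c\,\epsilon^{2\left(1-\frac{0.33}{\log(\log(1/\epsilon)\vee e)}\right)},$$ where the expectation is over $X_1,\dots,X_n$ drawn i.i.d. from the Huber contaminated distribution $(1-\epsilon)P_{f_\pi}+\epsilon Q$, the supremum is over all probability measures $\pi$ with $\mathrm{supp}(\pi)\subseteq[-M,M]^d$ and all probability measures $Q$ on $\mathbb R^d$, and the infimum is over all measurable density estimators $\widehat f=\widehat f(X_1,\dots,X_n)$, that is, estimators whose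 values are probability densities on $\mathbb R^d$. Here $a\vee b=\max\{a,b\}$. -/

import Mathlib

open MeasureTheory
open scoped ENNReal

noncomputable section

namespace RobustMixture

/-- The standard Gaussian density on `ℝ^d`: `φ_d(x) = (2π)^(-d/2) exp(-‖x‖₂² / 2)`. -/
def stdGaussianDensity (d : ℕ) (x : EuclideanSpace ℝ (Fin d)) : ℝ :=
  (2 * Real.pi) ^ (-(d : ℝ) / 2) * Real.exp (-‖x‖ ^ 2 / 2)

/-- The Gaussian location mixture density `f_π(x) = ∫ φ_d(x - θ) dπ(θ)`. -/
def mixtureDensity {d : ℕ} (π : Measure (EuclideanSpace ℝ (Fin d)))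
    (x : EuclideanSpace ℝ (Fin d)) : ℝ :=
  ∫ θ, stdGaussianDensity d (x - θ) ∂π

/-- The distribution `P_f` on `ℝ^d` with Lebesgue density `f`. -/
def distributionOf {d : ℕ} (f : EuclideanSpace ℝ (Fin d) → ℝ) :
    Measure (EuclideanSpace ℝ (Fin d)) :=
  volume.withDensity (fun x => ENNReal.ofReal (f x))

/-- The squared Hellinger distance `H²(p, q) = (1/2) ∫ (√p - √q)²` of two densities. -/
def hellingerSq {d : ℕ} (p q : EuclideanSpace ℝ (Fin d) → ℝ) : ℝ≥0∞ :=
  2⁻¹ * ∫⁻ x, ENNReal.ofReal ((√(p x) - √(q x)) ^ 2)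

/-- The cube `[-M, M]^d`. -/
def cube (d : ℕ) (M : ℝ) : Set (EuclideanSpace ℝ (Fin d)) :=
  {θ | ∀ i, θ i ∈ Set.Icc (-M) M}

/-- Huber's contaminated distribution `(1 - ε) P_{f_π} + ε Q`. -/
def huber {d : ℕ} (ε : ℝ) (π Q : Measure (EuclideanSpace ℝ (Fin d))) :
    Measure (EuclideanSpace ℝ (Fin d)) :=
  ENNReal.ofReal (1 - ε) • distributionOf (mixtureDensity π) + ENNReal.ofReal ε • Q

/-- A density estimator based on `n` observations in `ℝ^d`: for each sample `X` a probability
density `toFun X` on `ℝ^d`, depending measurably on the sample. -/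
structure DensityEstimator (d n : ℕ) where
  /-- the estimated density, as a function of the sample and the evaluation point -/
  toFun : (Fin n → EuclideanSpace ℝ (Fin d)) → EuclideanSpace ℝ (Fin d) → ℝ
  measurable' : Measurable (Function.uncurry toFun)
  nonneg' : ∀ X x, 0 ≤ toFun X x
  lintegral_eq_one' : ∀ X, ∫⁻ x, ENNReal.ofReal (toFun X x) = 1

/-- The risk `𝔼 [H²(f_π, f̂(X₁, …, Xₙ))]` where `X₁, …, Xₙ` are i.i.d. from
`(1 - ε) P_{f_π} + ε Q`. -/
def hellingerRisk {d n : ℕ} (ε : ℝ) (π Q : Measure (EuclideanSpace ℝ (Fin d)))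
    (fhat : DensityEstimator d n) : ℝ≥0∞ :=
  ∫⁻ X, hellingerSq (mixtureDensity π) (fhat.toFun X) ∂(Measure.pi fun _ : Fin n => huber ε π Q)

/-- The minimax risk: infimum over all density estimators of the supremum of the risk over all
probability measures `π` with support in `[-M, M]^d` and all probability measures `Q`. -/
def minimaxRisk (d n : ℕ) (M ε : ℝ) : ℝ≥0∞ :=
  ⨅ fhat : DensityEstimator d n,
    ⨆ (π : Measure (EuclideanSpace ℝ (Fin d))) (Q : Measure (EuclideanSpace ℝ (Fin d)))
      (_ : IsProbabilityMeasure π) (_ : π.support ⊆ cube d M) (_ : IsProbabilityMeasure Q),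
      hellingerRisk ε π Q fhat

end RobustMixture

end

noncomputable section

namespace RobustMixture

/-! The bound is a two-point argument. If two mixtures are within `ε` in `L¹`, each has a
contamination giving the same observed law (`exists_common_contamination`), so no sample of any size
separates them and the risk is at least a quarter of their squared Hellinger distance
(`hellingerSq_le_minimaxRisk`). It remains to find mixtures close in `L¹` but with `H²` much larger
than `ε²`.

Both mixing measures live on one coordinate axis, at `m + 1` equally spaced nodes with spacing `2r`.
The weights are binomial, tilted by `exp (t ^ 2 / 2)` and perturbed by `± κ (-1) ^ j`. The tilt
cancels the Gaussian normalization, so by `sum_weight_mul_exp` the densities relative to `φ` are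
proportional to `(2 cosh (r y)) ^ m ± κ (-2 sinh (r y)) ^ m`. With `r` of order `1 / m`, the
difference behaves like `κ (r y) ^ m`. Its `L¹` norm is of order `κ r ^ m (m / e) ^ (m / 2)`, from
`|y|` near `√m`, while `H²` is of order `κ ^ 2 r ^ (2 m) (2 m / e) ^ m`, from `y` near `√(2 m)`. So
`H²` beats the squared `L¹` distance by nearly `2 ^ m`; the estimates keep `1.8 ^ m * exp (-√(2
m))`.

The requirement `κ ≤ 1` limits `m` to order `L / log L`, where `L = log (1 / ε)`. Taking `m` about
`1.3 L / log L` makes the gain at least `exp (0.66 L / log L)`, which is the stated power of `ε`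
(`exists_degree`). -/

/-! ### Common contamination of two nearby laws. -/

lemma lintegral_tsub_comm {α : Type*} [MeasurableSpace α] {μ : Measure α} {u v : α → ℝ≥0∞}
    (hu : Measurable u) (hv : Measurable v) (hfin : ∫⁻ x, u x ∂μ ≠ ∞)
    (h : ∫⁻ x, u x ∂μ = ∫⁻ x, v x ∂μ) :
    ∫⁻ x, (v x - u x) ∂μ = ∫⁻ x, (u x - v x) ∂μ := by
  have h1 : ∫⁻ x, u x ∂μ + ∫⁻ x, (v x - u x) ∂μ = ∫⁻ x, u x ∂μ + ∫⁻ x, (u x - v x) ∂μ := by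
    rw [← lintegral_add_left hu]
    rw [h]
    rw [← lintegral_add_left hv]
    refine lintegral_congr fun x => ?_
    rw [add_tsub_eq_max, add_tsub_eq_max, max_comm]
  exact (ENNReal.add_right_inj hfin).1 h1

/-- Two distributions whose densities are close in `L¹` have a common Huber contamination. -/
lemma exists_common_contamination {α : Type*} [MeasurableSpace α] {μ : Measure α} {u v : α → ℝ≥0∞}
    (hu : Measurable u) (hv : Measurable v) (hu1 : ∫⁻ x, u x ∂μ = 1) (hv1 : ∫⁻ x, v x ∂μ = 1)
    {ε : ℝ} (hε : 0 < ε) (hT : ∫⁻ x, (v x - u x) ∂μ ≤ ENNReal.ofReal ε) :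
    ∃ Q₁ Q₂ : Measure α, IsProbabilityMeasure Q₁ ∧ IsProbabilityMeasure Q₂ ∧
      ENNReal.ofReal (1 - ε) • μ.withDensity u + ENNReal.ofReal ε • Q₁ =
        ENNReal.ofReal (1 - ε) • μ.withDensity v + ENNReal.ofReal ε • Q₂ := by
  set T := ∫⁻ x, (v x - u x) ∂μ with hTdef
  have hT' : ∫⁻ x, (u x - v x) ∂μ = T :=
    (lintegral_tsub_comm hu hv (by simp [hu1]) (by rw [hu1, hv1])).symm
  set e := ENNReal.ofReal ε with he
  -- Each contamination is `a` times the positive part that its own density lacks, topped up by `(1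
  -- - a * T)` copies of the law of `u`. Both mixtures become `(1 - ε) max u v` plus the same
  -- remainder.
  set a := ENNReal.ofReal (1 - ε) / e with ha
  have he0 : e ≠ 0 := by simp [he, hε]
  have het : e ≠ ∞ := by simp [he]
  have hea : e * a = ENNReal.ofReal (1 - ε) := ENNReal.mul_div_cancel he0 het
  have haT : a * T ≤ 1 := by
    calc a * T ≤ a * e := by gcongr
      _ = ENNReal.ofReal (1 - ε) := by rw [mul_comm, hea]
      _ ≤ 1 := by rw [ENNReal.ofReal_le_one]; linarith
  have key : ∀ w w' : α → ℝ≥0∞, Measurable w → Measurable w' → ∫⁻ x, (w x - w' x) ∂μ = T →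
      IsProbabilityMeasure (a • μ.withDensity (fun x => w x - w' x) +
        (1 - a * T) • μ.withDensity u) := by
    intro w w' _ _ hw
    refine ⟨?_⟩
    simp only [Measure.coe_add, Measure.coe_smul, Pi.add_apply, Pi.smul_apply,
      withDensity_apply _ MeasurableSet.univ, Measure.restrict_univ, hw, hu1, smul_eq_mul, mul_one]
    exact add_tsub_cancel_of_le haT
  refine ⟨_, _, key v u hv hu rfl, key u v hu hv hT', ?_⟩
  simp only [smul_add, smul_smul, hea]
  rw [← add_assoc, ← add_assoc, ← smul_add, ← smul_add, ← withDensity_add_left hu,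
    ← withDensity_add_left hv]
  congr 3
  ext x
  simp only [Pi.add_apply]
  rw [add_tsub_eq_max, add_tsub_eq_max, max_comm]

/-! ### Le Cam's two-point bound. -/

section TwoPoint

variable {d n : ℕ}

lemma hellingerSq_triangle {p q g : EuclideanSpace ℝ (Fin d) → ℝ}
    (hp : Measurable p) (hg : Measurable g) :
    hellingerSq p q ≤ 2 * (hellingerSq p g + hellingerSq q g) := by
  unfold hellingerSq
  have hm : Measurable fun x => ENNReal.ofReal ((√(p x) - √(g x)) ^ 2) := by fun_prop
  rw [← mul_add, ← lintegral_add_left hm, mul_left_comm,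
    ← lintegral_const_mul' _ _ (by simp : (2 : ℝ≥0∞) ≠ ∞)]
  gcongr with x
  rw [← ENNReal.ofReal_add (by positivity) (by positivity),
    show (2 : ℝ≥0∞) = ENNReal.ofReal 2 by simp, ← ENNReal.ofReal_mul (by norm_num)]
  apply ENNReal.ofReal_le_ofReal
  nlinarith [sq_nonneg ((√(p x) - √(g x)) + (√(q x) - √(g x)))]

lemma measurable_hellingerSq (fhat : DensityEstimator d n) {p : EuclideanSpace ℝ (Fin d) → ℝ}
    (hp : Measurable p) : Measurable fun X => hellingerSq p (fhat.toFun X) := by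
  unfold hellingerSq
  refine Measurable.const_mul (Measurable.lintegral_prod_right' (f := fun z :
    (Fin n → EuclideanSpace ℝ (Fin d)) × EuclideanSpace ℝ (Fin d) =>
      ENNReal.ofReal ((√(p z.2) - √(fhat.toFun z.1 z.2)) ^ 2)) ?_) _
  have := fhat.measurable'
  have h2 : Measurable fun z : (Fin n → EuclideanSpace ℝ (Fin d)) × EuclideanSpace ℝ (Fin d) =>
    fhat.toFun z.1 z.2 := this
  fun_prop

lemma measurable_estimator (fhat : DensityEstimator d n) (X : Fin n → EuclideanSpace ℝ (Fin d)) :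
    Measurable (fhat.toFun X) :=
  fhat.measurable'.comp (measurable_const.prodMk measurable_id)

/-- Le Cam's two-point bound when two mixtures have a common contamination. -/
lemma hellingerSq_le_minimaxRisk {M ε : ℝ} (hε : 0 < ε) (hε1 : ε ≤ 1)
    {π₁ π₂ : Measure (EuclideanSpace ℝ (Fin d))}
    (h₁ : IsProbabilityMeasure π₁) (h₂ : IsProbabilityMeasure π₂)
    (hs₁ : π₁.support ⊆ cube d M) (hs₂ : π₂.support ⊆ cube d M)
    (hm₁ : Measurable (mixtureDensity π₁)) (hm₂ : Measurable (mixtureDensity π₂))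
    (hi₁ : ∫⁻ x, ENNReal.ofReal (mixtureDensity π₁ x) = 1)
    (hi₂ : ∫⁻ x, ENNReal.ofReal (mixtureDensity π₂ x) = 1)
    (hT : ∫⁻ x, ENNReal.ofReal |mixtureDensity π₁ x - mixtureDensity π₂ x| ≤ ENNReal.ofReal ε) :
    4⁻¹ * hellingerSq (mixtureDensity π₁) (mixtureDensity π₂) ≤ minimaxRisk d n M ε := by
  obtain ⟨Q₁, Q₂, hQ₁, hQ₂, hQ⟩ := exists_common_contamination (μ := volume)
    (u := fun x => ENNReal.ofReal (mixtureDensity π₁ x))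
    (v := fun x => ENNReal.ofReal (mixtureDensity π₂ x))
    hm₁.ennreal_ofReal hm₂.ennreal_ofReal hi₁ hi₂ hε (by
      refine le_trans (lintegral_mono fun x => ?_) hT
      rw [tsub_le_iff_right]
      refine le_trans (ENNReal.ofReal_le_ofReal ?_) ENNReal.ofReal_add_le
      have := neg_abs_le (mixtureDensity π₁ x - mixtureDensity π₂ x)
      linarith)
  have hQ' : huber ε π₁ Q₁ = huber ε π₂ Q₂ := hQ
  unfold minimaxRisk
  refine le_iInf fun fhat => ?_
  set S := ⨆ (π : Measure (EuclideanSpace ℝ (Fin d))) (Q : Measure (EuclideanSpace ℝ (Fin d)))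
      (_ : IsProbabilityMeasure π) (_ : π.support ⊆ cube d M) (_ : IsProbabilityMeasure Q),
      hellingerRisk ε π Q fhat with hS
  have hr : ∀ π Q : Measure (EuclideanSpace ℝ (Fin d)), IsProbabilityMeasure π →
      π.support ⊆ cube d M → IsProbabilityMeasure Q → hellingerRisk ε π Q fhat ≤ S := by
    intro π Q h h' h''
    exact le_iSup_of_le π (le_iSup_of_le Q (le_iSup_of_le h (le_iSup_of_le h'
      (le_iSup_of_le h'' le_rfl))))
  have hr₁ := hr π₁ Q₁ h₁ hs₁ hQ₁
  have hr₂ := hr π₂ Q₂ h₂ hs₂ hQ₂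
  have hprob : IsProbabilityMeasure (huber ε π₁ Q₁) := by
    refine ⟨?_⟩
    simp only [huber, distributionOf, Measure.coe_add, Measure.coe_smul, Pi.add_apply,
      Pi.smul_apply, withDensity_apply _ MeasurableSet.univ, Measure.restrict_univ, hi₁,
      measure_univ, smul_eq_mul, mul_one]
    rw [← ENNReal.ofReal_add (by linarith) hε.le]
    simp
  have hsum : hellingerSq (mixtureDensity π₁) (mixtureDensity π₂) ≤
      2 * (hellingerRisk ε π₁ Q₁ fhat + hellingerRisk ε π₂ Q₂ fhat) := by
    unfold hellingerRisk
    -- Both risks are integrals against the same sample law, so the triangle inequality applies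
    -- pointwise in the sample.
    rw [← hQ', ← lintegral_add_left (measurable_hellingerSq fhat hm₁),
      ← lintegral_const_mul' _ _ (by simp : (2 : ℝ≥0∞) ≠ ∞)]
    calc hellingerSq (mixtureDensity π₁) (mixtureDensity π₂)
        = ∫⁻ _, hellingerSq (mixtureDensity π₁) (mixtureDensity π₂)
          ∂(Measure.pi fun _ : Fin n => huber ε π₁ Q₁) := by simp
      _ ≤ _ := lintegral_mono fun X =>
        hellingerSq_triangle hm₁ (measurable_estimator fhat X)
  rw [ENNReal.inv_mul_le_iff (by simp) (by simp)]
  calc _ ≤ _ := hsum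
    _ ≤ 2 * (S + S) := by gcongr
    _ = 4 * S := by ring

end TwoPoint

/-! ### Reduction to one dimension for mixing measures on an axis. -/

section Reduction

open ProbabilityTheory

variable {d : ℕ}

lemma measurable_stdGaussianDensity : Measurable (stdGaussianDensity d) := by
  unfold stdGaussianDensity
  fun_prop

lemma stdGaussianDensity_pos (x : EuclideanSpace ℝ (Fin d)) : 0 < stdGaussianDensity d x := by
  unfold stdGaussianDensity
  positivity

lemma stdGaussianDensity_eq_prod (x : EuclideanSpace ℝ (Fin d)) :
    stdGaussianDensity d x = ∏ i, gaussianPDFReal 0 1 (x i) := by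
  unfold stdGaussianDensity gaussianPDFReal
  rw [Finset.prod_mul_distrib, ← Real.exp_sum, EuclideanSpace.norm_sq_eq]
  congr 1
  · simp only [Finset.prod_const, Finset.card_univ, Fintype.card_fin, NNReal.coe_one, mul_one]
    rw [Real.sqrt_eq_rpow, ← Real.rpow_neg (by positivity), ← Real.rpow_natCast,
      ← Real.rpow_mul (by positivity)]
    congr 1
    ring
  · congr 1
    simp only [NNReal.coe_one, mul_one, sub_zero, Real.norm_eq_abs, sq_abs]
    rw [← Finset.sum_neg_distrib, Finset.sum_div]

lemma lintegral_prod_gaussianPDF (d : ℕ) :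
    ∫⁻ x : Fin d → ℝ, ∏ i, gaussianPDF 0 1 (x i) = 1 := by
  have hnn : ∀ x : Fin d → ℝ, 0 ≤ ∏ i, gaussianPDFReal 0 1 (x i) := fun x =>
    Finset.prod_nonneg fun i _ => gaussianPDFReal_nonneg _ _ _
  have h : ∀ x : Fin d → ℝ, ∏ i, gaussianPDF 0 1 (x i) =
      ENNReal.ofReal (∏ i, gaussianPDFReal 0 1 (x i)) := fun x => by
    rw [ENNReal.ofReal_prod_of_nonneg fun i _ => gaussianPDFReal_nonneg _ _ _]
    rfl
  have hint : Integrable fun x : Fin d → ℝ => ∏ i, gaussianPDFReal 0 1 (x i) :=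
    Integrable.fintype_prod fun _ => integrable_gaussianPDFReal 0 1
  simp_rw [h]
  rw [← ofReal_integral_eq_lintegral_ofReal hint (Filter.Eventually.of_forall hnn),
    integral_fintype_prod_volume_eq_pow (fun x => gaussianPDFReal 0 1 x),
    integral_gaussianPDFReal_eq_one 0 one_ne_zero]
  simp

/-- A function of one coordinate, integrated against the standard Gaussian density. -/
lemma lintegral_stdGaussianDensity_coord (i : Fin d) {G : ℝ → ℝ≥0∞} (hG : Measurable G) :
    ∫⁻ x, ENNReal.ofReal (stdGaussianDensity d x) * G (x i) =
      ∫⁻ y, ENNReal.ofReal (gaussianPDFReal 0 1 y) * G y := by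
  obtain ⟨k, rfl⟩ : ∃ k, d = k + 1 := ⟨d - 1, by have := i.pos; omega⟩
  have hpdf := measurable_gaussianPDF 0 1
  have h1 : ∀ x : EuclideanSpace ℝ (Fin (k + 1)),
      ENNReal.ofReal (stdGaussianDensity (k + 1) x) * G (x i) =
        (fun y : Fin (k + 1) → ℝ => (∏ j, gaussianPDF 0 1 (y j)) * G (y i)) (WithLp.ofLp x) := by
    intro x
    rw [stdGaussianDensity_eq_prod,
      ENNReal.ofReal_prod_of_nonneg fun i _ => gaussianPDFReal_nonneg _ _ _]
    rfl
  rw [lintegral_congr h1,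
    (PiLp.volume_preserving_ofLp (Fin (k + 1))).lintegral_comp
      (f := fun y : Fin (k + 1) → ℝ => (∏ j, gaussianPDF 0 1 (y j)) * G (y i)) (by fun_prop)]
  rw [← (volume_preserving_piFinSuccAbove (fun _ => ℝ) i).symm.lintegral_comp (by fun_prop)]
  have h2 : ∀ z : ℝ × (Fin k → ℝ),
      (∏ j, gaussianPDF 0 1 ((MeasurableEquiv.piFinSuccAbove (fun _ => ℝ) i).symm z j)) *
        G ((MeasurableEquiv.piFinSuccAbove (fun _ => ℝ) i).symm z i) =
      (gaussianPDF 0 1 z.1 * G z.1) * ∏ j, gaussianPDF 0 1 (z.2 j) := by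
    intro z
    rw [Fin.prod_univ_succAbove _ i]
    simp [MeasurableEquiv.piFinSuccAbove, Fin.insertNthEquiv]
    ring
  simp_rw [h2]
  rw [Measure.volume_eq_prod, lintegral_prod_mul (f := fun y => gaussianPDF 0 1 y * G y)
      (g := fun y : Fin k → ℝ => ∏ j, gaussianPDF 0 1 (y j)) (by fun_prop)
      (by have h : Measurable fun y : Fin k → ℝ => ∏ j, gaussianPDF 0 1 (y j) := by fun_prop
          exact h.aemeasurable),
    lintegral_prod_gaussianPDF, mul_one]
  rfl

/-- The cross term of `‖x - t e_i‖ ^ 2` involves only `x i`, so an axis mixture differs from `φ` by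
a factor depending on one coordinate. -/
lemma stdGaussianDensity_sub_single (i : Fin d) (x : EuclideanSpace ℝ (Fin d)) (t : ℝ) :
    stdGaussianDensity d (x - EuclideanSpace.single i t) =
      stdGaussianDensity d x * Real.exp (t * x i - t ^ 2 / 2) := by
  unfold stdGaussianDensity
  rw [mul_assoc, ← Real.exp_add, norm_sub_sq_real]
  congr 2
  simp [EuclideanSpace.inner_single_right]
  ring

/-- A finitely supported mixing distribution on a coordinate axis. -/
def axisMeasure {ι : Type*} (i : Fin d) (s : Finset ι) (w t : ι → ℝ) :
    Measure (EuclideanSpace ℝ (Fin d)) :=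
  ∑ j ∈ s, ENNReal.ofReal (w j) • Measure.dirac (EuclideanSpace.single i (t j))

variable {ι : Type*} {i : Fin d} {s : Finset ι} {w t : ι → ℝ}

lemma axisMeasure_isProbabilityMeasure (hw : ∀ j ∈ s, 0 ≤ w j) (h1 : ∑ j ∈ s, w j = 1) :
    IsProbabilityMeasure (axisMeasure i s w t) := by
  refine ⟨?_⟩
  simp only [axisMeasure, Measure.coe_finsetSum, Finset.sum_apply, Measure.smul_apply,
    measure_univ, smul_eq_mul, mul_one]
  rw [← ENNReal.ofReal_sum_of_nonneg hw, h1, ENNReal.ofReal_one]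

lemma isClosed_cube (d : ℕ) (M : ℝ) : IsClosed (cube d M) := by
  have : cube d M = ⋂ i, (fun θ : EuclideanSpace ℝ (Fin d) => θ i) ⁻¹' Set.Icc (-M) M := by
    ext θ
    simp [cube]
  rw [this]
  exact isClosed_iInter fun i => isClosed_Icc.preimage (by fun_prop)

lemma support_axisMeasure_subset {M : ℝ} (hM : 0 ≤ M) (ht : ∀ j ∈ s, |t j| ≤ M) :
    (axisMeasure i s w t).support ⊆ cube d M := by
  refine Measure.support_subset_of_isClosed (isClosed_cube d M) ?_
  rw [mem_ae_iff]
  simp only [axisMeasure, Measure.coe_finsetSum, Finset.sum_apply, Measure.smul_apply, smul_eq_mul]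
  refine Finset.sum_eq_zero fun j hj => ?_
  rw [Measure.dirac_apply' _ (isClosed_cube d M).measurableSet.compl,
    Set.indicator_of_notMem, mul_zero]
  simp only [Set.mem_compl_iff, not_not, cube, Set.mem_ofPred_eq]
  intro k
  rw [Set.mem_Icc, ← abs_le]
  by_cases hk : k = i
  · subst hk; simpa using ht j hj
  · simpa [hk] using hM

lemma mixtureDensity_axisMeasure (hw : ∀ j ∈ s, 0 ≤ w j) (x : EuclideanSpace ℝ (Fin d)) :
    mixtureDensity (axisMeasure i s w t) x =
      stdGaussianDensity d x * ∑ j ∈ s, w j * Real.exp (t j * x i - t j ^ 2 / 2) := by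
  unfold mixtureDensity axisMeasure
  rw [integral_finsetSum_measure, Finset.mul_sum]
  · refine Finset.sum_congr rfl fun j hj => ?_
    rw [integral_smul_measure, integral_dirac, stdGaussianDensity_sub_single,
      ENNReal.toReal_ofReal (hw j hj), smul_eq_mul]
    ring
  · intro j _
    refine Integrable.smul_measure (integrable_dirac ?_) (by simp)
    simp

lemma measurable_mixtureDensity_axisMeasure (hw : ∀ j ∈ s, 0 ≤ w j) :
    Measurable (mixtureDensity (axisMeasure i s w t)) := by
  have := measurable_stdGaussianDensity (d := d)
  rw [funext (mixtureDensity_axisMeasure hw)]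
  fun_prop

lemma lintegral_mixtureDensity_axisMeasure (hw : ∀ j ∈ s, 0 ≤ w j) (h1 : ∑ j ∈ s, w j = 1) :
    ∫⁻ x, ENNReal.ofReal (mixtureDensity (axisMeasure i s w t) x) = 1 := by
  have h : ∀ x : EuclideanSpace ℝ (Fin d),
      ENNReal.ofReal (mixtureDensity (axisMeasure i s w t) x) =
      ENNReal.ofReal (stdGaussianDensity d x) *
        ENNReal.ofReal (∑ j ∈ s, w j * Real.exp (t j * x i - t j ^ 2 / 2)) := fun x => by
    rw [mixtureDensity_axisMeasure hw, ENNReal.ofReal_mul (stdGaussianDensity_pos x).le]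
  simp_rw [h]
  rw [lintegral_stdGaussianDensity_coord i
    (G := fun y => ENNReal.ofReal (∑ j ∈ s, w j * Real.exp (t j * y - t j ^ 2 / 2)))
    (by fun_prop)]
  have h2 : ∀ y : ℝ, ENNReal.ofReal (gaussianPDFReal 0 1 y) *
      ENNReal.ofReal (∑ j ∈ s, w j * Real.exp (t j * y - t j ^ 2 / 2)) =
      ∑ j ∈ s, ENNReal.ofReal (w j) * ENNReal.ofReal (gaussianPDFReal (t j) 1 y) := by
    intro y
    rw [← ENNReal.ofReal_mul (gaussianPDFReal_nonneg _ _ _), Finset.mul_sum,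
      ENNReal.ofReal_sum_of_nonneg]
    · refine Finset.sum_congr rfl fun j hj => ?_
      rw [← ENNReal.ofReal_mul (hw j hj)]
      congr 1
      unfold gaussianPDFReal
      rw [mul_left_comm, mul_assoc, ← Real.exp_add]
      congr 3
      simp
      ring
    · intro j hj
      exact mul_nonneg (gaussianPDFReal_nonneg _ _ _) (mul_nonneg (hw j hj) (Real.exp_pos _).le)
  have hpdf := fun a => measurable_gaussianPDFReal a 1
  simp_rw [h2]
  rw [lintegral_finsetSum _ fun j _ => by fun_prop]
  simp_rw [lintegral_const_mul' _ _ ENNReal.ofReal_ne_top,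
    lintegral_gaussianPDFReal_eq_one _ one_ne_zero, mul_one]
  rw [← ENNReal.ofReal_sum_of_nonneg hw, h1, ENNReal.ofReal_one]

end Reduction

/-! ### The one-dimensional pair and its `L¹` and Hellinger estimates. -/

section Pair

open ProbabilityTheory

lemma sinh_le_mul_cosh {u : ℝ} (hu : 0 ≤ u) : Real.sinh u ≤ u * Real.cosh u := by
  have hd : ∀ x : ℝ, HasDerivAt (fun x => x * Real.cosh x - Real.sinh x)
      (1 * Real.cosh x + x * Real.sinh x - Real.cosh x) x := fun x =>
    ((hasDerivAt_id x).mul (Real.hasDerivAt_cosh x)).sub (Real.hasDerivAt_sinh x)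
  have hmono : MonotoneOn (fun x => x * Real.cosh x - Real.sinh x) (Set.Ici 0) := by
    refine monotoneOn_of_deriv_nonneg (convex_Ici 0) ?_ ?_ ?_
    · fun_prop
    · exact fun x _ => (hd x).differentiableAt.differentiableWithinAt
    · intro x hx
      rw [interior_Ici] at hx
      rw [(hd x).deriv]
      have : 0 ≤ x * Real.sinh x :=
        mul_nonneg (le_of_lt hx) (Real.sinh_nonneg_iff.2 (le_of_lt hx))
      linarith
  have := hmono (Set.mem_Ici.2 le_rfl) (Set.mem_Ici.2 hu) hu
  simp at this
  exact this

lemma abs_sinh_le (u : ℝ) : |Real.sinh u| ≤ |u| * Real.exp (u ^ 2 / 2) := by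
  rw [Real.abs_sinh]
  calc Real.sinh |u| ≤ |u| * Real.cosh |u| := sinh_le_mul_cosh (abs_nonneg u)
    _ ≤ |u| * Real.exp (|u| ^ 2 / 2) := by gcongr; exact Real.cosh_le_exp_half_sq _
    _ = _ := by rw [sq_abs]

/-- Factor `P - Q = (√P - √Q)(√P + √Q)` and use `(√P + √Q) ^ 2 ≤ 2 (P + Q)`. -/
lemma sq_sub_div_le_sq_sub_sqrt {P Q S : ℝ} (hP : 0 ≤ P) (hQ : 0 ≤ Q) (hS : 0 < S)
    (h : P + Q ≤ S) : (P - Q) ^ 2 / (2 * S) ≤ (√P - √Q) ^ 2 := by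
  rw [div_le_iff₀ (by positivity)]
  have h1 := Real.sq_sqrt hP
  have h2 := Real.sq_sqrt hQ
  have h3 : (P - Q) ^ 2 = (√P - √Q) ^ 2 * (√P + √Q) ^ 2 := by
    rw [← mul_pow, ← h1, ← h2, Real.sqrt_sq (Real.sqrt_nonneg _), Real.sqrt_sq (Real.sqrt_nonneg _)]
    ring
  rw [h3]
  gcongr
  nlinarith [sq_nonneg (√P - √Q)]

/-- Equally spaced nodes, symmetric about the origin. -/
def node (m : ℕ) (r : ℝ) (j : ℕ) : ℝ := (2 * j - m) * r

/-- Total mass of the binomial weights tilted by `exp (t ^ 2 / 2)`. -/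
def tiltedMass (m : ℕ) (r : ℝ) : ℝ :=
  ∑ j ∈ Finset.range (m + 1), (m.choose j : ℝ) * Real.exp (node m r j ^ 2 / 2)

/-- Normalized tilted binomial weights with an alternating perturbation of size `κ`. -/
def weight (m : ℕ) (r κ : ℝ) (j : ℕ) : ℝ :=
  (tiltedMass m r)⁻¹ * ((m.choose j : ℝ) * Real.exp (node m r j ^ 2 / 2)) * (1 + κ * (-1) ^ j)

variable {m : ℕ} {r κ : ℝ}

lemma two_pow_le_tiltedMass : 2 ^ m ≤ tiltedMass m r := by
  have h : ((2 : ℝ) ^ m) = ∑ j ∈ Finset.range (m + 1), (m.choose j : ℝ) := by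
    exact_mod_cast (Nat.sum_range_choose m).symm
  rw [h, tiltedMass]
  refine Finset.sum_le_sum fun j _ => le_mul_of_one_le_right (by positivity) ?_
  exact Real.one_le_exp (by positivity)

lemma tiltedMass_pos : 0 < tiltedMass m r := lt_of_lt_of_le (by positivity) two_pow_le_tiltedMass

lemma abs_node_le (hr : 0 ≤ r) {j : ℕ} (hj : j ∈ Finset.range (m + 1)) :
    |node m r j| ≤ m * r := by
  have hj' : (j : ℝ) ≤ m := by exact_mod_cast Nat.lt_succ_iff.1 (Finset.mem_range.1 hj)
  have hj0 : (0 : ℝ) ≤ j := by positivity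
  unfold node
  rw [abs_mul, abs_of_nonneg hr]
  gcongr
  rw [abs_le]
  constructor <;> linarith

lemma tiltedMass_le (hr : 0 ≤ r) (hmr : m * r ≤ 1) :
    tiltedMass m r ≤ 2 ^ m * Real.exp (1 / 2) := by
  have h : ((2 : ℝ) ^ m) = ∑ j ∈ Finset.range (m + 1), (m.choose j : ℝ) := by
    exact_mod_cast (Nat.sum_range_choose m).symm
  rw [h, tiltedMass, Finset.sum_mul]
  refine Finset.sum_le_sum fun j hj => ?_
  gcongr
  rw [← sq_abs]
  exact pow_le_one₀ (abs_nonneg _) ((abs_node_le hr hj).trans hmr)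

lemma weight_nonneg (hκ : |κ| ≤ 1) (j : ℕ) : 0 ≤ weight m r κ j := by
  have hA := tiltedMass_pos (m := m) (r := r)
  have : 0 ≤ 1 + κ * (-1) ^ j := by
    have h := neg_abs_le (κ * (-1) ^ j)
    rw [abs_mul, abs_neg_one_pow, mul_one] at h
    linarith
  unfold weight
  positivity

/-- The reflection `j ↦ m - j` fixes the tilted weights and, for odd `m`, flips the sign. Hence the
perturbation does not change the total mass. -/
lemma alternating_sum_eq_zero (hm : Odd m) :
    ∑ j ∈ Finset.range (m + 1),
      (m.choose j : ℝ) * Real.exp (node m r j ^ 2 / 2) * (-1) ^ j = 0 := by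
  set f : ℕ → ℝ := fun j => (m.choose j : ℝ) * Real.exp (node m r j ^ 2 / 2) * (-1) ^ j with hf
  have h : ∑ j ∈ Finset.range (m + 1), f j = -∑ j ∈ Finset.range (m + 1), f j := by
    conv_lhs => rw [← Finset.sum_flip]
    rw [← Finset.sum_neg_distrib]
    refine Finset.sum_congr rfl fun j hj => ?_
    have hj' : j ≤ m := Nat.lt_succ_iff.1 (Finset.mem_range.1 hj)
    simp only [hf]
    have hn : node m r (m - j) ^ 2 = node m r j ^ 2 := by
      unfold node
      rw [Nat.cast_sub hj']
      ring
    have hs : (-1 : ℝ) ^ (m - j) = -(-1) ^ j := by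
      have h1 : (-1 : ℝ) ^ (m - j) * (-1) ^ j = -1 := by
        rw [← pow_add, Nat.sub_add_cancel hj', hm.neg_one_pow]
      have h2 : ((-1 : ℝ) ^ j) * (-1) ^ j = 1 := by
        rw [← mul_pow]; simp
      linear_combination (-1 : ℝ) ^ j * h1 - (-1 : ℝ) ^ (m - j) * h2
    rw [hn, Nat.choose_symm hj', hs]
    ring
  linarith

lemma sum_weight (hm : Odd m) : ∑ j ∈ Finset.range (m + 1), weight m r κ j = 1 := by
  have h : ∀ j, weight m r κ j = (tiltedMass m r)⁻¹ *
      ((m.choose j : ℝ) * Real.exp (node m r j ^ 2 / 2) +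
        κ * ((m.choose j : ℝ) * Real.exp (node m r j ^ 2 / 2) * (-1) ^ j)) := by
    intro j; unfold weight; ring
  simp_rw [h]
  rw [← Finset.mul_sum, Finset.sum_add_distrib, ← Finset.mul_sum, alternating_sum_eq_zero hm,
    mul_zero, add_zero]
  exact inv_mul_cancel₀ tiltedMass_pos.ne'

/-- The Laplace transform of the tilted weights. -/
def profile (m : ℕ) (r κ y : ℝ) : ℝ :=
  (tiltedMass m r)⁻¹ * ((2 * Real.cosh (r * y)) ^ m + κ * (-(2 * Real.sinh (r * y))) ^ m)

/-- The tilt in the weights cancels `exp (-t ^ 2 / 2)`, leaving two binomial expansions in `exp (± r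
y)`, with and without alternating signs. -/
lemma sum_weight_mul_exp (y : ℝ) :
    ∑ j ∈ Finset.range (m + 1),
      weight m r κ j * Real.exp (node m r j * y - node m r j ^ 2 / 2) = profile m r κ y := by
  have hc : 2 * Real.cosh (r * y) = Real.exp (r * y) + Real.exp (-(r * y)) := by
    rw [Real.cosh_eq]; ring
  have hs : -(2 * Real.sinh (r * y)) = -Real.exp (r * y) + Real.exp (-(r * y)) := by
    rw [Real.sinh_eq]; ring
  unfold profile
  rw [hc, hs, add_pow, add_pow, Finset.mul_sum, ← Finset.sum_add_distrib, Finset.mul_sum]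
  refine Finset.sum_congr rfl fun j hj => ?_
  have hj' : j ≤ m := Nat.lt_succ_iff.1 (Finset.mem_range.1 hj)
  have he : Real.exp (node m r j * y - node m r j ^ 2 / 2) * Real.exp (node m r j ^ 2 / 2) =
      Real.exp (r * y) ^ j * Real.exp (-(r * y)) ^ (m - j) := by
    rw [← Real.exp_add, ← Real.exp_nat_mul, ← Real.exp_nat_mul, ← Real.exp_add, Nat.cast_sub hj']
    congr 1
    unfold node
    ring
  rw [neg_pow (Real.exp (r * y)) j]
  unfold weight
  linear_combination ((tiltedMass m r)⁻¹ * (m.choose j : ℝ) * (1 + κ * (-1) ^ j)) * he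

lemma profile_nonneg (hκ : |κ| ≤ 1) (y : ℝ) : 0 ≤ profile m r κ y := by
  rw [← sum_weight_mul_exp]
  exact Finset.sum_nonneg fun j _ => mul_nonneg (weight_nonneg hκ j) (Real.exp_pos _).le

lemma measurable_profile : Measurable (profile m r κ) := by
  unfold profile
  fun_prop

lemma abs_pow_mul_gaussian_le (hm : 20 ≤ m) (hr : 0 ≤ r) (hmr : m * r ≤ 1) (y : ℝ) :
    gaussianPDFReal 0 1 y * |Real.sinh (r * y)| ^ m ≤
      5 * r ^ m * √(m / (0.9 * Real.exp 1)) ^ m * gaussianPDFReal 0 20 y := by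
  have hm0 : (0 : ℝ) < m := by positivity
  have hm20 : (20 : ℝ) ≤ m := by exact_mod_cast hm
  -- This is `t ≤ exp (t - 1)` at `t = 0.9 y ^ 2 / m`. Using `0.9` rather than `1` leaves part of
  -- the Gaussian decay unspent.
  have hy : |y| ≤ √(m / (0.9 * Real.exp 1)) * Real.exp (0.45 * y ^ 2 / m) := by
    rw [← abs_of_pos (Real.exp_pos (0.45 * y ^ 2 / m)), ← Real.sqrt_sq_eq_abs,
      ← Real.sqrt_sq_eq_abs, ← Real.sqrt_mul (by positivity)]
    apply Real.sqrt_le_sqrt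
    have h := Real.add_one_le_exp (0.9 * y ^ 2 / m - 1)
    have h2 : Real.exp (0.45 * y ^ 2 / m) ^ 2 = Real.exp (0.9 * y ^ 2 / m - 1) * Real.exp 1 := by
      rw [← Real.exp_nat_mul, ← Real.exp_add]
      congr 1
      push_cast
      ring
    rw [h2]
    calc y ^ 2 = m / 0.9 * (0.9 * y ^ 2 / m - 1 + 1) := by field_simp; ring
      _ ≤ m / 0.9 * Real.exp (0.9 * y ^ 2 / m - 1) := by gcongr
      _ = _ := by field_simp
  have hym : |y| ^ m ≤ √(m / (0.9 * Real.exp 1)) ^ m * Real.exp (0.45 * y ^ 2) := by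
    calc |y| ^ m ≤ (√(m / (0.9 * Real.exp 1)) * Real.exp (0.45 * y ^ 2 / m)) ^ m := by gcongr
      _ = _ := by
        rw [mul_pow, ← Real.exp_nat_mul]
        congr 2
        field_simp
  have hs : |Real.sinh (r * y)| ^ m ≤ r ^ m * |y| ^ m * Real.exp (y ^ 2 / 40) := by
    calc |Real.sinh (r * y)| ^ m ≤ (|r * y| * Real.exp ((r * y) ^ 2 / 2)) ^ m := by
          gcongr; exact abs_sinh_le _
      _ = r ^ m * |y| ^ m * Real.exp (m * ((r * y) ^ 2 / 2)) := by
          rw [mul_pow, abs_mul, abs_of_nonneg hr, mul_pow, ← Real.exp_nat_mul]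
      _ ≤ _ := by
          gcongr
          have h1 : (m * r) * (m * r) ≤ 1 := by nlinarith [mul_nonneg hm0.le hr]
          have h2 : m * r ^ 2 ≤ 1 / 20 := by nlinarith [sq_nonneg r]
          nlinarith [sq_nonneg y]
  have h5 : √20 ≤ 5 := by
    rw [Real.sqrt_le_left (by norm_num)]; norm_num
  -- The exponents balance as `1/2 - 0.45 - 1/40 = 1/40`, which is the decay rate of variance `20`.
  have hg : gaussianPDFReal 0 1 y * Real.exp (0.45 * y ^ 2) * Real.exp (y ^ 2 / 40) =
      √20 * gaussianPDFReal 0 20 y := by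
    unfold gaussianPDFReal
    rw [mul_assoc, mul_assoc, ← Real.exp_add, ← Real.exp_add, ← mul_assoc √20]
    congr 1
    · simp only [NNReal.coe_one, NNReal.coe_ofNat, mul_one]
      rw [Real.sqrt_mul (by positivity) 20]
      field_simp
    · congr 1
      simp
      ring
  have hg0 := gaussianPDFReal_nonneg 0 1 y
  have hg20 := gaussianPDFReal_nonneg 0 20 y
  calc gaussianPDFReal 0 1 y * |Real.sinh (r * y)| ^ m
      ≤ gaussianPDFReal 0 1 y * (r ^ m *
        (√(m / (0.9 * Real.exp 1)) ^ m * Real.exp (0.45 * y ^ 2)) * Real.exp (y ^ 2 / 40)) := by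
        refine mul_le_mul_of_nonneg_left (hs.trans ?_) hg0
        gcongr
    _ = r ^ m * √(m / (0.9 * Real.exp 1)) ^ m * (√20 * gaussianPDFReal 0 20 y) := by
        rw [← hg]; ring
    _ ≤ r ^ m * √(m / (0.9 * Real.exp 1)) ^ m * (5 * gaussianPDFReal 0 20 y) := by gcongr
    _ = _ := by ring

lemma profile_sub_profile (y : ℝ) : profile m r κ y - profile m r (-κ) y =
    2 * κ * (tiltedMass m r)⁻¹ * (-(2 * Real.sinh (r * y))) ^ m := by
  unfold profile; ring

lemma profile_add_profile (y : ℝ) : profile m r κ y + profile m r (-κ) y =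
    2 * (tiltedMass m r)⁻¹ * (2 * Real.cosh (r * y)) ^ m := by
  unfold profile; ring

lemma gaussian_mul_abs_profile_sub_le (hm : 20 ≤ m) (hr : 0 ≤ r) (hmr : m * r ≤ 1) (hκ : 0 ≤ κ)
    (y : ℝ) : gaussianPDFReal 0 1 y * |profile m r κ y - profile m r (-κ) y| ≤
      10 * κ * r ^ m * √(m / (0.9 * Real.exp 1)) ^ m * gaussianPDFReal 0 20 y := by
  have hA := tiltedMass_pos (m := m) (r := r)
  have hA2 : (tiltedMass m r)⁻¹ * 2 ^ m ≤ 1 := by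
    rw [inv_mul_le_iff₀ hA, mul_one]
    exact two_pow_le_tiltedMass
  have hg0 := gaussianPDFReal_nonneg 0 1 y
  rw [profile_sub_profile, abs_mul, abs_of_nonneg (by positivity), abs_pow, abs_neg, abs_mul,
    abs_two, mul_pow]
  calc _ = 2 * κ * ((tiltedMass m r)⁻¹ * 2 ^ m) *
        (gaussianPDFReal 0 1 y * |Real.sinh (r * y)| ^ m) := by ring
    _ ≤ 2 * κ * 1 * (5 * r ^ m * √(m / (0.9 * Real.exp 1)) ^ m * gaussianPDFReal 0 20 y) := by
      have := abs_pow_mul_gaussian_le hm hr hmr y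
      gcongr
    _ = _ := by ring

/-- The window starts at the maximizer `y = √(2 m)` of `y ^ (2 m) exp (-y ^ 2 / 2)`; its unit length
costs the factor `exp (-√(2 m))`. The factor `exp (-5)` collects `4` from the `cosh` denominator and
`1/2` each from the tilted mass and the Gaussian density. -/
lemma le_gaussian_mul_sq_sub_sqrt_profile (hm : 20 ≤ m) (hr : 0 ≤ r) (hmr : m * r ≤ 1)
    (hκ : |κ| ≤ 1) {y : ℝ} (hy1 : √(2 * m) ≤ y) (hy2 : y ≤ √(2 * m) + 1) :
    (√(2 * Real.pi))⁻¹ * Real.exp (-5) *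
        (κ ^ 2 * r ^ (2 * m) * (2 * m / Real.exp 1) ^ m * Real.exp (-√(2 * m))) ≤
      gaussianPDFReal 0 1 y * (√(profile m r κ y) - √(profile m r (-κ) y)) ^ 2 := by
  have hA := tiltedMass_pos (m := m) (r := r)
  have hm20 : (20 : ℝ) ≤ m := by exact_mod_cast hm
  have hs := Real.sq_sqrt (show (0 : ℝ) ≤ 2 * m by positivity)
  have hs0 := Real.sqrt_nonneg (2 * (m : ℝ))
  have hs1 : 1 ≤ √(2 * (m : ℝ)) := by rw [Real.one_le_sqrt]; linarith
  set s := √(2 * (m : ℝ))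
  have hy0 : 0 ≤ y := hs0.trans hy1
  have hysq : y ^ 2 ≤ 2 * m + 2 * s + 1 := by nlinarith
  have hysq8 : y ^ 2 ≤ 8 * m := by nlinarith
  have hyl : (2 * (m : ℝ)) ^ m ≤ y ^ (2 * m) := by
    rw [pow_mul, ← hs]; gcongr
  have hmain := sq_sub_div_le_sq_sub_sqrt (profile_nonneg (m := m) (r := r) hκ y)
    (profile_nonneg (m := m) (r := r) (κ := -κ) (by rwa [abs_neg]) y)
    (S := 2 * (tiltedMass m r)⁻¹ * (2 * Real.cosh (r * y)) ^ m)
    (by have := Real.cosh_pos (r * y); positivity) (profile_add_profile y).le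
  have hcosh : Real.cosh (r * y) ^ m ≤ Real.exp 4 := by
    calc Real.cosh (r * y) ^ m ≤ Real.exp ((r * y) ^ 2 / 2) ^ m := by
          have := Real.cosh_pos (r * y)
          gcongr; exact Real.cosh_le_exp_half_sq _
      _ = Real.exp (m * ((r * y) ^ 2 / 2)) := by rw [← Real.exp_nat_mul]
      _ ≤ Real.exp 4 := by
          gcongr
          have h1 : (m * r) * (m * r) ≤ 1 := by
            have : 0 ≤ m * r := by positivity
            nlinarith
          have h2 : m * r ^ 2 * y ^ 2 ≤ m * r ^ 2 * (8 * m) := by gcongr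
          nlinarith
  have hcp := Real.cosh_pos (r * y)
  have hsinh : r ^ (2 * m) * (2 * (m : ℝ)) ^ m ≤ Real.sinh (r * y) ^ (2 * m) := by
    calc r ^ (2 * m) * (2 * (m : ℝ)) ^ m ≤ r ^ (2 * m) * y ^ (2 * m) := by gcongr
      _ = (r * y) ^ (2 * m) := (mul_pow _ _ _).symm
      _ ≤ _ := by
        have : r * y ≤ Real.sinh (r * y) := Real.self_le_sinh_iff.2 (by positivity)
        gcongr
  have hratio : Real.exp (-(1 / 2)) ≤ (tiltedMass m r)⁻¹ * 2 ^ m := by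
    rw [Real.exp_neg, inv_mul_eq_div, le_div_iff₀ hA, inv_mul_le_iff₀ (Real.exp_pos _), mul_comm]
    exact tiltedMass_le hr hmr
  have hprof : κ ^ 2 * Real.exp (-(1 / 2)) * (r ^ (2 * m) * (2 * (m : ℝ)) ^ m) * Real.exp (-4) ≤
      (√(profile m r κ y) - √(profile m r (-κ) y)) ^ 2 := by
    refine le_trans ?_ hmain
    rw [profile_sub_profile]
    have heq : (2 * κ * (tiltedMass m r)⁻¹ * (-(2 * Real.sinh (r * y))) ^ m) ^ 2 /
        (2 * (2 * (tiltedMass m r)⁻¹ * (2 * Real.cosh (r * y)) ^ m)) =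
        κ ^ 2 * ((tiltedMass m r)⁻¹ * 2 ^ m) * Real.sinh (r * y) ^ (2 * m) *
          (Real.cosh (r * y) ^ m)⁻¹ := by
      rw [mul_pow, ← pow_mul, mul_comm m 2, (even_two_mul m).neg_pow, mul_pow 2 (Real.sinh _),
        mul_pow 2 (Real.cosh _), pow_mul 2 2 m]
      have h4 : ((2 : ℝ) ^ 2) ^ m = 2 ^ m * 2 ^ m := by rw [← mul_pow]; norm_num
      rw [h4]
      field_simp
    rw [heq, Real.exp_neg 4]
    gcongr
  have hpdf : (√(2 * Real.pi))⁻¹ * Real.exp (-m - s - 1 / 2) ≤ gaussianPDFReal 0 1 y := by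
    unfold gaussianPDFReal
    simp only [NNReal.coe_one, mul_one, sub_zero]
    gcongr
    linarith
  calc _ = (√(2 * Real.pi))⁻¹ * Real.exp (-m - s - 1 / 2) *
        (κ ^ 2 * Real.exp (-(1 / 2)) * (r ^ (2 * m) * (2 * (m : ℝ)) ^ m) * Real.exp (-4)) := by
        have h1 : Real.exp 1 ^ m = Real.exp m := by rw [← Real.exp_nat_mul]; simp
        have h2 : Real.exp (-m - s - 1 / 2) * Real.exp (-(1 / 2)) * Real.exp (-4) =
            Real.exp (-5) * Real.exp (-s) * (Real.exp m)⁻¹ := by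
          simp only [← Real.exp_neg, ← Real.exp_add]
          congr 1
          ring
        rw [div_pow, h1, div_eq_mul_inv]
        linear_combination -((√(2 * Real.pi))⁻¹ * κ ^ 2 * (r ^ (2 * m) * (2 * (m : ℝ)) ^ m)) * h2
    _ ≤ _ := by
        have := gaussianPDFReal_nonneg 0 1 y
        gcongr

end Pair

/-! ### Transfer to dimension `d` and choice of spacing and amplitude. -/

section Bound

open ProbabilityTheory

variable {d n : ℕ} {M ε : ℝ}

/-- The mixing distribution carrying the perturbed weights on the axis `i`. -/
def mixing (i : Fin d) (m : ℕ) (r κ : ℝ) : Measure (EuclideanSpace ℝ (Fin d)) :=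
  axisMeasure i (Finset.range (m + 1)) (weight m r κ) (node m r)

lemma mixtureDensity_mixing (i : Fin d) {m : ℕ} {r κ : ℝ} (hκ : |κ| ≤ 1)
    (x : EuclideanSpace ℝ (Fin d)) :
    mixtureDensity (mixing i m r κ) x = stdGaussianDensity d x * profile m r κ (x i) := by
  rw [mixing, mixtureDensity_axisMeasure fun j _ => weight_nonneg hκ j, sum_weight_mul_exp]

lemma lintegral_abs_mixtureDensity_sub_le (i : Fin d) {m : ℕ} {r κ : ℝ} (hm : 20 ≤ m)
    (hr : 0 ≤ r) (hmr : m * r ≤ 1) (hκ0 : 0 ≤ κ) (hκ1 : κ ≤ 1) :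
    ∫⁻ x, ENNReal.ofReal |mixtureDensity (mixing i m r κ) x - mixtureDensity (mixing i m r (-κ)) x|
      ≤ ENNReal.ofReal (10 * κ * r ^ m * √(m / (0.9 * Real.exp 1)) ^ m) := by
  have hκ : |κ| ≤ 1 := by rwa [abs_of_nonneg hκ0]
  have hκ' : |-κ| ≤ 1 := by rwa [abs_neg]
  have hmp := measurable_profile (m := m) (r := r) (κ := κ)
  have hmp' := measurable_profile (m := m) (r := r) (κ := -κ)
  have h : ∀ x : EuclideanSpace ℝ (Fin d),
      ENNReal.ofReal |mixtureDensity (mixing i m r κ) x - mixtureDensity (mixing i m r (-κ)) x| =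
      ENNReal.ofReal (stdGaussianDensity d x) *
        ENNReal.ofReal |profile m r κ (x i) - profile m r (-κ) (x i)| := by
    intro x
    rw [mixtureDensity_mixing i hκ, mixtureDensity_mixing i hκ', ← mul_sub, abs_mul,
      abs_of_pos (stdGaussianDensity_pos x), ENNReal.ofReal_mul (stdGaussianDensity_pos x).le]
  simp_rw [h]
  rw [lintegral_stdGaussianDensity_coord i
    (G := fun y => ENNReal.ofReal |profile m r κ y - profile m r (-κ) y|) (by fun_prop)]
  calc _ ≤ ∫⁻ y, ENNReal.ofReal (10 * κ * r ^ m * √(m / (0.9 * Real.exp 1)) ^ m) *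
        ENNReal.ofReal (gaussianPDFReal 0 20 y) := by
        refine lintegral_mono fun y => ?_
        rw [← ENNReal.ofReal_mul (gaussianPDFReal_nonneg _ _ _),
          ← ENNReal.ofReal_mul (by positivity)]
        exact ENNReal.ofReal_le_ofReal (gaussian_mul_abs_profile_sub_le hm hr hmr hκ0 y)
    _ = _ := by
        rw [lintegral_const_mul' _ _ ENNReal.ofReal_ne_top,
          lintegral_gaussianPDFReal_eq_one _ (by norm_num), mul_one]

lemma le_hellingerSq_mixing (i : Fin d) {m : ℕ} {r κ : ℝ} (hm : 20 ≤ m)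
    (hr : 0 ≤ r) (hmr : m * r ≤ 1) (hκ : |κ| ≤ 1) :
    2⁻¹ * ENNReal.ofReal ((√(2 * Real.pi))⁻¹ * Real.exp (-5) *
        (κ ^ 2 * r ^ (2 * m) * (2 * m / Real.exp 1) ^ m * Real.exp (-√(2 * m)))) ≤
      hellingerSq (mixtureDensity (mixing i m r κ)) (mixtureDensity (mixing i m r (-κ))) := by
  have hκ' : |-κ| ≤ 1 := by rwa [abs_neg]
  have hmp := measurable_profile (m := m) (r := r) (κ := κ)
  have hmp' := measurable_profile (m := m) (r := r) (κ := -κ)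
  unfold hellingerSq
  gcongr
  have h : ∀ x : EuclideanSpace ℝ (Fin d),
      ENNReal.ofReal ((√(mixtureDensity (mixing i m r κ) x) -
        √(mixtureDensity (mixing i m r (-κ)) x)) ^ 2) =
      ENNReal.ofReal (stdGaussianDensity d x) *
        ENNReal.ofReal ((√(profile m r κ (x i)) - √(profile m r (-κ) (x i))) ^ 2) := by
    intro x
    have hφ := (stdGaussianDensity_pos x).le
    rw [mixtureDensity_mixing i hκ, mixtureDensity_mixing i hκ', Real.sqrt_mul hφ,
      Real.sqrt_mul hφ, ← mul_sub, mul_pow, Real.sq_sqrt hφ, ENNReal.ofReal_mul hφ]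
  simp_rw [h]
  rw [lintegral_stdGaussianDensity_coord i
    (G := fun y => ENNReal.ofReal ((√(profile m r κ y) - √(profile m r (-κ) y)) ^ 2))
    (by fun_prop)]
  set C := (√(2 * Real.pi))⁻¹ * Real.exp (-5) *
        (κ ^ 2 * r ^ (2 * m) * (2 * m / Real.exp 1) ^ m * Real.exp (-√(2 * m)))
  calc ENNReal.ofReal C
      = ∫⁻ _ in Set.Icc (√(2 * (m : ℝ))) (√(2 * (m : ℝ)) + 1), ENNReal.ofReal C := by simp
    _ ≤ ∫⁻ y in Set.Icc (√(2 * (m : ℝ))) (√(2 * (m : ℝ)) + 1),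
        ENNReal.ofReal (gaussianPDFReal 0 1 y) *
          ENNReal.ofReal ((√(profile m r κ y) - √(profile m r (-κ) y)) ^ 2) := by
        refine setLIntegral_mono' measurableSet_Icc fun y hy => ?_
        rw [← ENNReal.ofReal_mul (gaussianPDFReal_nonneg _ _ _)]
        exact ENNReal.ofReal_le_ofReal
          (le_gaussian_mul_sq_sub_sqrt_profile hm hr hmr hκ hy.1 hy.2)
    _ ≤ _ := setLIntegral_le_lintegral _ _

lemma le_minimaxRisk_of_perturbation (i : Fin d) (hε : 0 < ε) (hε1 : ε ≤ 1) (hM : 0 < M) {m : ℕ}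
    {r κ : ℝ} (hodd : Odd m) (hm : 20 ≤ m) (hr : 0 ≤ r) (hmr : m * r ≤ 1) (hmM : m * r ≤ M)
    (hκ0 : 0 ≤ κ) (hκ1 : κ ≤ 1)
    (hκε : 10 * κ * r ^ m * √(m / (0.9 * Real.exp 1)) ^ m ≤ ε) :
    ENNReal.ofReal ((√(2 * Real.pi))⁻¹ * Real.exp (-5) / 8 *
        (κ ^ 2 * r ^ (2 * m) * (2 * m / Real.exp 1) ^ m * Real.exp (-√(2 * m)))) ≤
      minimaxRisk d n M ε := by
  have hκ : |κ| ≤ 1 := by rwa [abs_of_nonneg hκ0]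
  have hκ' : |-κ| ≤ 1 := by rwa [abs_neg]
  have hw := fun j (_ : j ∈ Finset.range (m + 1)) => weight_nonneg (m := m) (r := r) hκ j
  have hw' := fun j (_ : j ∈ Finset.range (m + 1)) => weight_nonneg (m := m) (r := r) hκ' j
  have hnode : ∀ j ∈ Finset.range (m + 1), |node m r j| ≤ M := fun j hj =>
    (abs_node_le hr hj).trans hmM
  refine le_trans ?_ (hellingerSq_le_minimaxRisk (n := n) (M := M) hε hε1
    (π₁ := mixing i m r κ) (π₂ := mixing i m r (-κ))
    (axisMeasure_isProbabilityMeasure hw (sum_weight hodd))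
    (axisMeasure_isProbabilityMeasure hw' (sum_weight hodd))
    (support_axisMeasure_subset hM.le hnode) (support_axisMeasure_subset hM.le hnode)
    (measurable_mixtureDensity_axisMeasure hw) (measurable_mixtureDensity_axisMeasure hw')
    (lintegral_mixtureDensity_axisMeasure hw (sum_weight hodd))
    (lintegral_mixtureDensity_axisMeasure hw' (sum_weight hodd))
    ((lintegral_abs_mixtureDensity_sub_le i hm hr hmr hκ0 hκ1).trans
      (ENNReal.ofReal_le_ofReal hκε)))
  refine le_trans ?_ (mul_le_mul_right (le_hellingerSq_mixing i hm hr hmr hκ) 4⁻¹)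
  have h8 : (4 : ℝ≥0∞)⁻¹ * 2⁻¹ = ENNReal.ofReal (1 / 8) := by
    rw [← ENNReal.mul_inv (by simp) (by simp), one_div, ENNReal.ofReal_inv_of_pos (by norm_num)]
    norm_num
  rw [← mul_assoc 4⁻¹ 2⁻¹, h8, ← ENNReal.ofReal_mul (by norm_num)]
  apply ENNReal.ofReal_le_ofReal
  apply le_of_eq
  ring

lemma le_minimaxRisk_of_degree (i : Fin d) {ε' : ℝ} (hε' : 0 < ε') (hε : ε' ≤ ε) (hε1 : ε ≤ 1)
    (hM : 0 < M) {m : ℕ} (hodd : Odd m) (hm : 20 ≤ m) (hεm : ε' ≤ (min M 1 / (2 * √m)) ^ m) :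
    ENNReal.ofReal ((√(2 * Real.pi))⁻¹ * Real.exp (-5) / 800 *
        (ε' ^ 2 * (1.8 ^ m * Real.exp (-√(2 * m))))) ≤ minimaxRisk d n M ε := by
  have hm0 : (0 : ℝ) < m := by positivity
  have hM0 : 0 < min M 1 := lt_min hM one_pos
  set r := min M 1 / m with hr
  have hr0 : 0 < r := by positivity
  have hmr : m * r = min M 1 := by rw [hr]; field_simp
  set D := √(m / (0.9 * Real.exp 1)) ^ m with hD
  have hD0 : 0 < D := by positivity
  have hD2 : D ^ 2 = (m / (0.9 * Real.exp 1)) ^ m := by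
    rw [hD, ← pow_mul, mul_comm m 2, pow_mul, Real.sq_sqrt (by positivity)]
  have hrD : (min M 1 / (2 * √m)) ^ m ≤ r ^ m * D := by
    rw [hD, ← mul_pow]
    have h1 : √(m : ℝ) / 2 ≤ √(m / (0.9 * Real.exp 1)) := by
      apply Real.le_sqrt_of_sq_le
      rw [div_pow, Real.sq_sqrt hm0.le]
      gcongr
      nlinarith [Real.exp_one_lt_d9]
    have h2 : min M 1 / (2 * √m) = r * (√(m : ℝ) / 2) := by
      rw [hr]
      have := Real.sq_sqrt hm0.le
      field_simp
      linarith
    rw [h2]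
    gcongr
  -- This `κ` makes the `L¹` bound equal to `ε'`; then `κ ^ 2` cancels `r ^ (2 m) * D ^ 2`, leaving
  -- `1.8 ^ m` with `1.8 = 2 * 0.9`.
  refine le_trans (le_of_eq ?_) (le_minimaxRisk_of_perturbation (n := n) (r := r)
    (κ := ε' / (10 * (r ^ m * D))) i (hε'.trans_le hε) hε1 hM hodd hm hr0.le
    (hmr.trans_le (min_le_right _ _)) (hmr.trans_le (min_le_left _ _)) (by positivity) ?_ ?_)
  · congr 1
    have h18 : ((2 * m / Real.exp 1) ^ m : ℝ) = 1.8 ^ m * D ^ 2 := by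
      rw [hD2, ← mul_pow]
      congr 1
      field_simp
      norm_num
    rw [h18, mul_comm 2 m, pow_mul]
    field_simp
    norm_num
  · rw [div_le_one (by positivity)]
    have : 0 < r ^ m * D := by positivity
    linarith
  · refine le_trans (le_of_eq ?_) hε
    rw [← hD]
    field_simp

end Bound

/-! ### Choice of the degree `m`. -/

section Asymptotics

open Filter

lemma exists_degree {M : ℝ} (hM : 0 < M) :
    ∃ L₀ : ℝ, Real.exp 1 ≤ L₀ ∧ ∀ L, L₀ ≤ L → ∃ m : ℕ, Odd m ∧ 20 ≤ m ∧
      Real.exp (-L) ≤ (M / (2 * √m)) ^ m ∧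
      Real.exp (0.66 * (L / Real.log L)) ≤ 1.8 ^ m * Real.exp (-√(2 * m)) := by
  have hlog := Real.tendsto_log_atTop
  have hu : Tendsto (fun L : ℝ => L / Real.log L) atTop atTop := by
    have h1 : Tendsto (fun L : ℝ => Real.log L / L) atTop (nhdsWithin 0 (Set.Ioi 0)) := by
      refine tendsto_nhdsWithin_iff.2 ⟨?_, ?_⟩
      · simpa using Real.isLittleO_log_id_atTop.tendsto_div_nhds_zero
      · filter_upwards [eventually_gt_atTop 1] with L hL
        exact div_pos (Real.log_pos hL) (by linarith)
    refine h1.inv_tendsto_nhdsGT_zero.congr fun L => ?_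
    simp
  set C := |Real.log (2 / M)|
  obtain ⟨L₀, hL₀⟩ := eventually_atTop.1
    ((hlog.eventually_ge_atTop (5 * C + 2)).and
      ((hu.eventually_ge_atTop 1000).and (eventually_ge_atTop (Real.exp 1))))
  refine ⟨L₀, (hL₀ L₀ le_rfl).2.2, fun L hL => ?_⟩
  obtain ⟨h1, h2, h3⟩ := hL₀ L hL
  have hC0 : 0 ≤ C := abs_nonneg _
  have hL0 : 0 < L := (Real.exp_pos 1).trans_le h3
  have hl0 : 0 < Real.log L := by linarith
  set u := L / Real.log L with hu'
  have huL : u * Real.log L = L := by rw [hu']; field_simp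
  -- The odd degree `2 k + 1` lies between `1.3 u` and `1.4 u`. The upper bound gives `1.4 * 0.7 =
  -- 0.98 < 1` in the amplitude constraint, the lower one `1.3 * (0.58 - 0.05) > 0.66` in the gain.
  set k := ⌈0.65 * u⌉₊
  have hk1 : 0.65 * u ≤ k := Nat.le_ceil _
  have hk2 : (k : ℝ) < 0.65 * u + 1 := Nat.ceil_lt_add_one (by positivity)
  have hmc : ((2 * k + 1 : ℕ) : ℝ) = 2 * k + 1 := by push_cast; ring
  refine ⟨2 * k + 1, odd_two_mul_add_one k, ?_, ?_, ?_⟩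
  · have : (20 : ℝ) ≤ ((2 * k + 1 : ℕ) : ℝ) := by rw [hmc]; linarith
    exact_mod_cast this
  · set m := 2 * k + 1
    have hm0 : (0 : ℝ) < m := by rw [hmc]; linarith
    have hmu : (m : ℝ) ≤ 1.4 * u := by rw [hmc]; linarith
    have hmL : (m : ℝ) ≤ L := by nlinarith
    have hlm : Real.log m ≤ Real.log L := Real.log_le_log hm0 hmL
    rw [← Real.le_log_iff_exp_le (by positivity), Real.log_pow,
      show M / (2 * √(m : ℝ)) = (2 / M)⁻¹ * (√(m : ℝ))⁻¹ by field_simp,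
      Real.log_mul (by positivity) (by positivity), Real.log_inv, Real.log_inv,
      Real.log_sqrt hm0.le]
    have hC := le_abs_self (Real.log (2 / M))
    have h4 : Real.log (2 / M) + Real.log m / 2 ≤ 0.7 * Real.log L := by
      change _ ≤ C at hC
      linarith
    have h5 : m * (Real.log (2 / M) + Real.log m / 2) ≤ m * (0.7 * Real.log L) := by gcongr
    have h6 : m * (0.7 * Real.log L) ≤ 1.4 * u * (0.7 * Real.log L) := by gcongr
    have h7 : 1.4 * u * (0.7 * Real.log L) = 0.98 * L := by linear_combination 0.98 * huL
    linarith
  · set m := 2 * k + 1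
    have hm1 : 1.3 * u ≤ m := by rw [hmc]; linarith
    have hs : √(2 * (m : ℝ)) ≤ 0.05 * m := by
      rw [Real.sqrt_le_left (by positivity)]
      nlinarith
    have h18 : Real.exp 0.58 ≤ 1.8 := by
      refine (Real.exp_bound' (n := 4) (by norm_num) (by norm_num) (by norm_num)).trans ?_
      norm_num [Finset.sum_range_succ, Nat.factorial]
    calc Real.exp (0.66 * u) ≤ Real.exp (m * 0.58 + -√(2 * (m : ℝ))) := by
          gcongr
          linarith
      _ = Real.exp 0.58 ^ m * Real.exp (-√(2 * m)) := by rw [Real.exp_add, Real.exp_nat_mul]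
      _ ≤ _ := by gcongr

end Asymptotics

end RobustMixture

end

theorem theorem6 (d : ℕ) (hd : 1 ≤ d) (M : ℝ) (hM : 0 < M) :
    ∃ c : ℝ, 0 < c ∧ ∀ (n : ℕ) (ε : ℝ), 0 < ε → ε ≤ 1 →
      ENNReal.ofReal
          (c * ε ^ (2 * (1 - 0.33 / Real.log (max (Real.log (1 / ε)) (Real.exp 1)))))
        ≤ RobustMixture.minimaxRisk d n M ε := by
  obtain ⟨L₀, hL₀, hdeg⟩ := RobustMixture.exists_degree (lt_min hM one_pos)
  have hL₀0 : 0 < L₀ := (Real.exp_pos 1).trans_le hL₀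
  set a : ℝ := (√(2 * Real.pi))⁻¹ * Real.exp (-5) / 800
  have ha : 0 < a := by positivity
  refine ⟨a * Real.exp (-L₀) ^ 2, by positivity, fun n ε hε hε1 => ?_⟩
  have hexp1 : Real.exp (-L₀) ≤ 1 := Real.exp_le_one_iff.2 (by linarith)
  by_cases hεL : ε ≤ Real.exp (-L₀)
  · set L := Real.log (1 / ε) with hL
    have hLε : Real.exp (-L) = ε := by
      rw [hL, one_div, Real.log_inv, neg_neg, Real.exp_log hε]
    have hLL : L₀ ≤ L := by
      rw [← hLε, Real.exp_le_exp] at hεL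
      linarith
    obtain ⟨m, hodd, hm, h1, h2⟩ := hdeg L hLL
    rw [hLε] at h1
    refine le_trans (ENNReal.ofReal_le_ofReal ?_)
      (RobustMixture.le_minimaxRisk_of_degree (n := n) ⟨0, hd⟩ hε le_rfl hε1 hM hodd hm h1)
    rw [max_eq_left (hL₀.trans hLL)]
    have hpow : ε ^ (2 * (1 - 0.33 / Real.log L)) =
        ε ^ 2 * Real.exp (0.66 * (L / Real.log L)) := by
      rw [← hLε, ← Real.exp_mul, ← Real.exp_nat_mul, ← Real.exp_add]
      congr 1
      push_cast
      ring
    rw [hpow]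
    have : Real.exp (-L₀) ^ 2 ≤ 1 := pow_le_one₀ (Real.exp_pos _).le hexp1
    calc a * Real.exp (-L₀) ^ 2 * (ε ^ 2 * Real.exp (0.66 * (L / Real.log L)))
        ≤ a * 1 * (ε ^ 2 * (1.8 ^ m * Real.exp (-√(2 * m)))) := by gcongr
      _ = _ := by rw [mul_one]
  -- For larger `ε` the perturbation at the fixed level `exp (-L₀)` suffices: the target exponent is
  -- nonnegative, so the power of `ε` is at most `1`.
  · obtain ⟨m, hodd, hm, h1, h2⟩ := hdeg L₀ le_rfl
    refine le_trans (ENNReal.ofReal_le_ofReal ?_)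
      (RobustMixture.le_minimaxRisk_of_degree (n := n) ⟨0, hd⟩ (Real.exp_pos (-L₀)) (not_le.1 hεL).le hε1 hM
        hodd hm h1)
    have hlog1 : 1 ≤ Real.log (max (Real.log (1 / ε)) (Real.exp 1)) := by
      rw [Real.le_log_iff_exp_le (lt_max_of_lt_right (Real.exp_pos 1))]
      exact le_max_right _ _
    have hle : (0.33 : ℝ) / Real.log (max (Real.log (1 / ε)) (Real.exp 1)) ≤ 1 := by
      rw [div_le_one (by linarith)]
      linarith
    have hone : 1 ≤ 1.8 ^ m * Real.exp (-√(2 * m)) := by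
      refine le_trans (Real.one_le_exp ?_) h2
      have := Real.log_nonneg (show 1 ≤ L₀ by linarith [Real.add_one_le_exp 1])
      positivity
    calc a * Real.exp (-L₀) ^ 2 * ε ^ (2 * (1 - 0.33 / Real.log (max (Real.log (1 / ε))
          (Real.exp 1))))
        ≤ a * Real.exp (-L₀) ^ 2 * 1 := by
          gcongr
          exact Real.rpow_le_one hε.le hε1 (by linarith)
      _ ≤ a * Real.exp (-L₀) ^ 2 * (1.8 ^ m * Real.exp (-√(2 * m))) := by gcongr
      _ = _ := by ring
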